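/- Let $\Omega\subset\mathbb R^3$ be a bounded domain with $C^1$ boundary and outward unit normal $n$, and suppose that $\Omega$ satisfies the uniform circumscribed sphere condition with some radius $R>0$: for every $x\in\partial\Omega$ there is a ball $B_R$ of radius $R$ with $x\in\partial B_R$ and $\overline\Omega\subset\overline{B_R}$. For $x\in\Omega$ and $v\in\mathbb R^3\setminus\{0\}$ put $$\tau_{x,v}:=\inf\{s\ge 0: x-sv\notin\Omega\},\quad q(x,v):=x-\tau_{x,v}v,\quad N(x,v):=-n(q(x,v))\cdot\frac{v}{|v|},\quad w(x,v):=\frac{|v|}{|v|+1}N(x,v).$$ For $\alpha>0$ let $|g|_{\infty,\alpha}:=\operatorname{ess\,sup}_{(x,v)\in\Omega\times\mathbb R^3}e^{\alpha|v|^2}|g(x,v)|$, and let $\hat L^\infty_\alpha$ be the space of functions $f$ on $\Omega\times\mathbb R^3$, with weak gradients $\nabla_xf,\nabla_vf\in L^1_{\rm loc}(\Omega\times\mathbb R^3)$, such that $$|f|_{\infty,\alpha}+|w\nabla_xf|_{\infty,\alpha}+|w\nabla_vf|_{\infty,\alpha}<\infty.$$ Then, for every $\alpha>0$ and every $1\le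 p<3$, $$\hat L^\infty_\alpha\subseteq W^{1,p}(\Omega\times\mathbb R^3).$$ -/

import Mathlib

open MeasureTheory Set Topology
open scoped ContDiff ENNReal

noncomputable section

/-- Physical space (and velocity space) `ℝ³` with the Euclidean norm. -/
abbrev E3 : Type := EuclideanSpace ℝ (Fin 3)

/-- The phase domain `Ω × ℝ³` of pairs `(x, v)`. -/
def phaseDomain (Ω : Set E3) : Set (E3 × E3) := Ω ×ˢ univ

/-! ### Geometry of the space domain -/

/-- `ρ` is a `C¹` local defining function of `Ω` at `z`: it is `C¹` near `z`, vanishes at `z` with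
nonzero gradient, and `Ω = {ρ < 0}` near `z`. -/
structure IsLocalDefiningFunction (Ω : Set E3) (z : E3) (ρ : E3 → ℝ) : Prop where
  contDiffAt : ContDiffAt ℝ 1 ρ z
  map_eq_zero : ρ z = 0
  gradient_ne_zero : gradient ρ z ≠ 0
  mem_iff : ∀ᶠ y in 𝓝 z, (y ∈ Ω ↔ ρ y < 0)

/-- The boundary of `Ω` is of class `C¹`. -/
def HasC1Boundary (Ω : Set E3) : Prop :=
  ∀ z ∈ frontier Ω, ∃ ρ : E3 → ℝ, IsLocalDefiningFunction Ω z ρ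

open Classical in
/-- The outward unit normal `n(z) = ∇ρ(z) / |∇ρ(z)|` at a `C¹` boundary point `z` of `Ω`. It does
not depend on the local defining function `ρ`. (Elsewhere the value is the dummy `0`.) -/
def outwardNormal (Ω : Set E3) (z : E3) : E3 :=
  if h : ∃ ρ : E3 → ℝ, IsLocalDefiningFunction Ω z ρ then
    ‖gradient h.choose z‖⁻¹ • gradient h.choose z
  else 0

/-- The uniform circumscribed sphere condition with radius `R`. -/
def UniformCircumscribedSphere (Ω : Set E3) (R : ℝ) : Prop :=
  0 < R ∧ ∀ x ∈ frontier Ω, ∃ c : E3,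
    x ∈ Metric.sphere c R ∧ closure Ω ⊆ Metric.closedBall c R

/-! ### The backward exit point and the weight -/

/-- `τ_{x,v} = inf {s ≥ 0 : x - s v ∉ Ω}`. -/
def exitTime (Ω : Set E3) (x v : E3) : ℝ := sInf {s : ℝ | 0 ≤ s ∧ x - s • v ∈ Ωᶜ}

/-- `q(x,v) = x - τ_{x,v} v`. -/
def exitPoint (Ω : Set E3) (x v : E3) : E3 := x - exitTime Ω x v • v

/-- `N(x,v) = - n(q(x,v)) · v / |v|`. -/
def exitCosine (Ω : Set E3) (x v : E3) : ℝ :=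
  -inner ℝ (outwardNormal Ω (exitPoint Ω x v)) (‖v‖⁻¹ • v)

/-- `w(x,v) = |v| / (|v| + 1) * N(x,v)`. -/
def kineticWeight (Ω : Set E3) (x v : E3) : ℝ := ‖v‖ / (‖v‖ + 1) * exitCosine Ω x v

/-! ### Weak gradients and function spaces -/

/-- `gx` and `gv` are the weak gradients `∇ₓ f` and `∇ᵥ f` of `f` on the open set `U ⊆ ℝ³ × ℝ³`. -/
structure HasWeakGradients (U : Set (E3 × E3)) (f : E3 × E3 → ℝ) (gx gv : E3 × E3 → E3) :
    Prop where
  locallyIntegrableOn : LocallyIntegrableOn f U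
  locallyIntegrableOn_x : LocallyIntegrableOn gx U
  locallyIntegrableOn_v : LocallyIntegrableOn gv U
  integral_x : ∀ φ : E3 × E3 → ℝ, ContDiff ℝ ∞ φ → HasCompactSupport φ → tsupport φ ⊆ U →
    ∀ i : Fin 3, ∫ z in U, f z * fderiv ℝ φ z (EuclideanSpace.single i 1, 0) =
      -∫ z in U, gx z i * φ z
  integral_v : ∀ φ : E3 × E3 → ℝ, ContDiff ℝ ∞ φ → HasCompactSupport φ → tsupport φ ⊆ U →
    ∀ i : Fin 3, ∫ z in U, f z * fderiv ℝ φ z (0, EuclideanSpace.single i 1) =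
      -∫ z in U, gv z i * φ z

/-- `|g|_{∞,α} = ess sup_{(x,v) ∈ Ω × ℝ³} exp(α |v|²) |g(x,v)|`, with values in `[0,∞]`. -/
def expSupNorm {F : Type*} [NormedAddCommGroup F] (Ω : Set E3) (α : ℝ) (g : E3 × E3 → F) : ℝ≥0∞ :=
  essSup (fun z => ENNReal.ofReal (Real.exp (α * ‖z.2‖ ^ 2) * ‖g z‖))
    (volume.restrict (phaseDomain Ω))

/-- `|g|_{∞,α,w} = |w g|_{∞,α}`. -/
def weightedExpSupNorm (Ω : Set E3) (α : ℝ) (g : E3 × E3 → E3) : ℝ≥0∞ :=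
  expSupNorm Ω α (fun z => kineticWeight Ω z.1 z.2 • g z)

/-- The space `L̂^∞_α` of functions with
`|f|_{∞,α} + |∇ₓ f|_{∞,α,w} + |∇ᵥ f|_{∞,α,w} < ∞`. -/
def hatLInfty (Ω : Set E3) (α : ℝ) : Set (E3 × E3 → ℝ) :=
  {f | ∃ gx gv : E3 × E3 → E3, HasWeakGradients (phaseDomain Ω) f gx gv ∧
    expSupNorm Ω α f + weightedExpSupNorm Ω α gx + weightedExpSupNorm Ω α gv < ⊤}

/-- The Sobolev space `W^{1,p}(U)` for an open set `U ⊆ ℝ³ × ℝ³`. -/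
def sobolevW1 (U : Set (E3 × E3)) (p : ℝ≥0∞) : Set (E3 × E3 → ℝ) :=
  {f | MemLp f p (volume.restrict U) ∧ ∃ gx gv : E3 × E3 → E3, HasWeakGradients U f gx gv ∧
    MemLp gx p (volume.restrict U) ∧ MemLp gv p (volume.restrict U)}

end

/-!
If the closure of `Ω` lies in a closed ball of radius `R` and centre `c` whose sphere passes through
`q ∈ ∂Ω`, then `n(q) = (q - c) / R`. Two consequences hold at every boundary point: the chord
through `x` that starts at the exit point `q(x, v)` has length at most `2 R N(x, v)`, and
`|q - q'| ≤ R |n(q) - n(q')|`.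

Cover the set of normals by `O(t⁻²)` balls of radius `t`. If `N(x, v) ≤ t` and `n(q(x, v))` is
within `t` of the normal `n(q)`, then `v` lies in a band of angular width `O(t)` about the plane
`n(q)⊥`, and `x` lies in a slab of radius `O(t)` and thickness `O(t²)` about the tangent plane at
`q`, whose volume is `O(t⁴)`. Hence, against an integrable radial density in `v`, the set `{N ≤ t}`
has measure `O(t⁻² · t · t⁴) = O(t³)`, and `N ^ (-p)` is integrable for `p < 3`.
-/

open scoped NNReal

section InnerProductSpace

variable {E : Type*} [NormedAddCommGroup E] [InnerProductSpace ℝ E]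

theorem eq_of_forall_inner_neg_imp_inner_nonpos {n m : E} (hn : ‖n‖ = 1) (hm : ‖m‖ = 1)
    (h : ∀ u, inner ℝ n u < 0 → inner ℝ m u ≤ 0) : n = m := by
  by_contra hne
  have hlt : inner ℝ n m < 1 := (inner_lt_one_iff_real_of_norm_eq_one hn hm).2 hne
  have hle := h (m - n) (by rw [inner_sub_right, inner_self_eq_one_of_norm_eq_one hn]; linarith)
  rw [inner_sub_right, inner_self_eq_one_of_norm_eq_one hm, real_inner_comm] at hle
  linarith

theorem sq_norm_sub_le_two_mul_inner_of_mem_closedBall {c y z : E} {R : ℝ}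
    (hz : z ∈ Metric.sphere c R) (hy : y ∈ Metric.closedBall c R) :
    ‖z - y‖ ^ 2 ≤ 2 * inner ℝ (z - c) (z - y) := by
  rw [mem_sphere_iff_norm] at hz
  rw [mem_closedBall_iff_norm, ← hz] at hy
  have hexpand := norm_sub_sq_real (z - c) (z - y)
  rw [sub_sub_sub_cancel_left] at hexpand
  have : ‖y - c‖ ^ 2 ≤ ‖z - c‖ ^ 2 := by gcongr
  linarith

end InnerProductSpace

/-- The slab of half-width `s` about the hyperplane through `q` with normal `n`,
intersected with the closed ball of radius `r` about `q`. -/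
def slab {E : Type*} [NormedAddCommGroup E] [InnerProductSpace ℝ E] (n q : E) (r s : ℝ) : Set E :=
  {x | ‖x - q‖ ≤ r ∧ |inner ℝ n (x - q)| ≤ s}

/-- The cone of vectors almost orthogonal to `n`: their angle with the hyperplane `n⊥` has sine at
most `ε` when `n` is a unit vector. -/
def conicalBand {E : Type*} [NormedAddCommGroup E] [InnerProductSpace ℝ E] (n : E) (ε : ℝ) :
    Set E :=
  {v | |inner ℝ n v| ≤ ε * ‖v‖}

theorem exists_linearIsometryEquiv_inner_eq {ι : Type*} [Fintype ι]
    {n : EuclideanSpace ℝ ι} (hn : ‖n‖ = 1) (i : ι) :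
    ∃ A : EuclideanSpace ℝ ι ≃ₗᵢ[ℝ] EuclideanSpace ℝ ι, ∀ v, A v i = inner ℝ n v := by
  classical
  have hnorm : ‖n‖ = ‖(EuclideanSpace.single i 1 : EuclideanSpace ℝ ι)‖ := by simp [hn]
  refine ⟨(ℝ ∙ (n - EuclideanSpace.single i 1))ᗮ.reflection, fun v => ?_⟩
  rw [← LinearIsometryEquiv.inner_map_map (ℝ ∙ (n - EuclideanSpace.single i 1))ᗮ.reflection n v,
    Submodule.reflection_sub hnorm]
  simp [EuclideanSpace.inner_single_left]

theorem volume_slab_le {d : ℕ} {n : EuclideanSpace ℝ (Fin (d + 1))} (hn : ‖n‖ = 1)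
    (q : EuclideanSpace ℝ (Fin (d + 1))) {r s : ℝ} (hr : 0 ≤ r) (hs : 0 ≤ s) :
    volume (slab n q r s) ≤ ENNReal.ofReal (2 * s * (2 * r) ^ d) := by
  obtain ⟨A, hA⟩ := exists_linearIsometryEquiv_inner_eq hn 0
  let b : Fin (d + 1) → ℝ := Fin.cons s fun _ => r
  have hsub : slab n q r s ⊆ (fun x => WithLp.ofLp (A (x - q))) ⁻¹' Icc (-b) b := by
    rintro x ⟨hxr, hxs⟩
    have hcoord : ∀ i, |A (x - q) i| ≤ b i := by
      refine Fin.cases ?_ fun i => ?_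
      · rwa [hA]
      · rw [← A.norm_map] at hxr
        exact (PiLp.norm_apply_le _ _).trans hxr
    exact ⟨fun i => (abs_le.1 (hcoord i)).1, fun i => (abs_le.1 (hcoord i)).2⟩
  have hmp : MeasurePreserving (fun x => WithLp.ofLp (A (x - q))) volume volume :=
    (PiLp.volume_preserving_ofLp (Fin (d + 1))).comp
      (A.measurePreserving.comp (measurePreserving_sub_right volume q))
  calc volume (slab n q r s)
      ≤ volume (Icc (-b) b) :=
        (measure_mono hsub).trans_eq (hmp.measure_preimage measurableSet_Icc.nullMeasurableSet)
    _ = ENNReal.ofReal (2 * s * (2 * r) ^ d) := by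
        rw [Real.volume_Icc_pi, Fin.prod_univ_succ]
        simp only [b, Pi.neg_apply, Fin.cons_zero, Fin.cons_succ, sub_neg_eq_add, ← two_mul]
        rw [Finset.prod_const, Finset.card_univ, Fintype.card_fin,
          ← ENNReal.ofReal_pow (by positivity), ← ENNReal.ofReal_mul (by positivity)]

section SpherePacking

open Module

variable {E : Type*} [NormedAddCommGroup E] [NormedSpace ℝ E] [FiniteDimensional ℝ E] [Nontrivial E]
  {δ : ℝ≥0}

theorem card_mul_pow_le_of_isSeparated_sphere {s : Finset E} (hs : ↑s ⊆ Metric.sphere (0 : E) 1)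
    (hδ2 : δ ≤ 2) (hsep : Metric.IsSeparated δ (s : Set E)) :
    s.card * (δ / 2 : ℝ) ^ finrank ℝ E ≤
      (1 + δ / 2 : ℝ) ^ finrank ℝ E - (1 - δ / 2 : ℝ) ^ finrank ℝ E := by
  borelize E
  let μ : Measure E := Measure.addHaar
  have : (δ : ℝ) ≤ 2 := hδ2
  have hdisj : (s : Set E).PairwiseDisjoint fun x => Metric.ball x (δ / 2 : ℝ) := by
    intro x hx y hy hxy
    have hδ : (δ : ℝ≥0∞) < edist x y := hsep hx hy hxy
    rw [edist_nndist, ENNReal.coe_lt_coe, ← NNReal.coe_lt_coe, coe_nndist] at hδ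
    exact Metric.ball_disjoint_ball (by linarith)
  -- Comparing with the volume of the shell about the sphere, not of the whole ball, gains a
  -- factor `δ`.
  have hshell : ⋃ x ∈ s, Metric.ball x (δ / 2 : ℝ) ⊆
      Metric.closedBall 0 (1 + δ / 2) \ Metric.closedBall 0 (1 - δ / 2) := by
    refine iUnion₂_subset fun x hx y hy => ?_
    have hx1 : dist x 0 = 1 := hs hx
    rw [Metric.mem_ball] at hy
    rw [mem_sdiff, Metric.mem_closedBall, Metric.mem_closedBall, not_le]
    constructor
    · linarith [dist_triangle y x 0]
    · linarith [dist_triangle_left x 0 y]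
  have hvolume := measureReal_mono (μ := μ) hshell
    (measure_ne_top_of_subset sdiff_subset measure_closedBall_lt_top.ne)
  rw [measureReal_biUnion_finset hdisj fun _ _ => measurableSet_ball,
    measureReal_sdiff (Metric.closedBall_subset_closedBall (by linarith [δ.coe_nonneg]))
      measurableSet_closedBall measure_closedBall_lt_top.ne] at hvolume
  simp only [← Measure.addHaar_real_closedBall_eq_addHaar_real_ball] at hvolume
  rw [Finset.sum_congr rfl fun x _ => μ.addHaar_real_closedBall x (by positivity),
    μ.addHaar_real_closedBall 0 (by positivity), μ.addHaar_real_closedBall 0 (by linarith),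
    Finset.sum_const, nsmul_eq_mul, ← mul_assoc, ← sub_mul] at hvolume
  exact le_of_mul_le_mul_right hvolume
    (ENNReal.toReal_pos (Metric.measure_ball_pos μ 0 one_pos).ne' measure_ball_lt_top.ne)

theorem card_mul_pow_pred_le_of_isSeparated_sphere {s : Finset E}
    (hs : ↑s ⊆ Metric.sphere (0 : E) 1) (hδ0 : 0 < δ) (hδ2 : δ ≤ 2)
    (hsep : Metric.IsSeparated δ (s : Set E)) :
    s.card * (δ / 2 : ℝ) ^ (finrank ℝ E - 1) ≤ finrank ℝ E * 2 ^ finrank ℝ E := by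
  have hδ0' : (0 : ℝ) < δ := hδ0
  have : (δ : ℝ) ≤ 2 := hδ2
  have hshell : (1 + δ / 2 : ℝ) ^ finrank ℝ E - (1 - δ / 2 : ℝ) ^ finrank ℝ E ≤
      δ * finrank ℝ E * 2 ^ (finrank ℝ E - 1) := by
    refine (le_abs_self _).trans ((abs_pow_sub_pow_le _ _ _).trans ?_)
    rw [add_sub_sub_cancel, add_halves, abs_of_pos hδ0',
      abs_of_nonneg (by linarith : 0 ≤ 1 + (δ / 2 : ℝ)),
      abs_of_nonneg (by linarith : 0 ≤ 1 - (δ / 2 : ℝ))]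
    gcongr
    exact max_le (by linarith) (by linarith)
  refine le_of_mul_le_mul_right ?_ (half_pos hδ0')
  calc (s.card * (δ / 2 : ℝ) ^ (finrank ℝ E - 1)) * (δ / 2)
      = s.card * (δ / 2 : ℝ) ^ finrank ℝ E := by
        rw [mul_assoc, pow_sub_one_mul finrank_pos.ne']
    _ ≤ δ * finrank ℝ E * 2 ^ (finrank ℝ E - 1) :=
        (card_mul_pow_le_of_isSeparated_sphere hs hδ2 hsep).trans hshell
    _ = finrank ℝ E * 2 ^ finrank ℝ E * (δ / 2) := by
        rw [← pow_sub_one_mul (finrank_pos (R := ℝ) (M := E)).ne' (2 : ℝ)]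
        ring

theorem packingNumber_ne_top_of_totallyBounded {X : Type*} [PseudoEMetricSpace X] {A : Set X}
    (hA : TotallyBounded A) (hδ : δ ≠ 0) : Metric.packingNumber δ A ≠ ⊤ := by
  obtain ⟨C, -, hfin, hcover⟩ := Metric.exists_finite_isCover_of_totallyBounded
    (half_pos hδ.bot_lt).ne' hA
  have hle := Metric.packingNumber_two_mul_le_externalCoveringNumber (δ / 2) A
  rw [mul_div_cancel₀ δ two_ne_zero] at hle
  exact ((hle.trans hcover.externalCoveringNumber_le_encard).trans_lt hfin.encard_lt_top).ne

theorem exists_finset_isCover_of_subset_sphere {A : Set E} (hA : A ⊆ Metric.sphere (0 : E) 1)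
    (hδ0 : 0 < δ) (hδ2 : δ ≤ 2) :
    ∃ C : Finset E, ↑C ⊆ A ∧ Metric.IsCover δ A (C : Set E) ∧
      C.card * (δ / 2 : ℝ) ^ (finrank ℝ E - 1) ≤ finrank ℝ E * 2 ^ finrank ℝ E := by
  have hpack : Metric.packingNumber δ A ≠ ⊤ :=
    packingNumber_ne_top_of_totallyBounded
      ((isCompact_sphere (0 : E) 1).totallyBounded.subset hA) hδ0.ne'
  have hfin : (Metric.maximalSeparatedSet δ A).Finite :=
    encard_ne_top_iff.1 (by rwa [Metric.encard_maximalSeparatedSet hpack])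
  have hsub : ↑hfin.toFinset ⊆ A := by
    simpa using Metric.maximalSeparatedSet_subset
  refine ⟨hfin.toFinset, hsub, ?_, ?_⟩
  · simpa using Metric.isCover_maximalSeparatedSet hpack
  · refine card_mul_pow_pred_le_of_isSeparated_sphere (hsub.trans hA) hδ0 hδ2 ?_
    simpa using Metric.isSeparated_maximalSeparatedSet

end SpherePacking

section ConeIntegral

open Module Measure
open scoped Pointwise

variable {E : Type*} [NormedAddCommGroup E] [NormedSpace ℝ E] [FiniteDimensional ℝ E] [Nontrivial E]
  [MeasurableSpace E] [BorelSpace E] (μ : Measure E) [μ.IsAddHaarMeasure] {S : Set E}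

theorem toSphere_preimage_of_cone (hS : MeasurableSet S)
    (hcone : ∀ r : ℝ, 0 < r → ∀ v ∈ S, r • v ∈ S) :
    μ.toSphere (Subtype.val ⁻¹' S) = finrank ℝ E * μ (S ∩ Metric.ball 0 1) := by
  rw [μ.toSphere_apply' (measurable_subtype_coe hS), Subtype.image_preimage_coe]
  have hsector : Ioo (0 : ℝ) 1 • (Metric.sphere (0 : E) 1 ∩ S) = (S ∩ Metric.ball 0 1) \ {0} := by
    ext v
    simp only [mem_smul, mem_sdiff, mem_inter_iff, mem_sphere_zero_iff_norm, mem_ball_zero_iff,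
      mem_singleton_iff]
    constructor
    · rintro ⟨r, ⟨hr0, hr1⟩, u, ⟨hu, huS⟩, rfl⟩
      refine ⟨⟨hcone r hr0 u huS, ?_⟩, smul_ne_zero hr0.ne' (norm_ne_zero_iff.1 (by simp [hu]))⟩
      rwa [norm_smul, hu, mul_one, Real.norm_of_nonneg hr0.le]
    · rintro ⟨⟨hvS, hv1⟩, hv0⟩
      have hv : 0 < ‖v‖ := norm_pos_iff.2 hv0
      exact ⟨‖v‖, ⟨hv, hv1⟩, ‖v‖⁻¹ • v,
        ⟨norm_smul_inv_norm hv0, hcone _ (inv_pos.2 hv) v hvS⟩, smul_inv_smul₀ hv.ne' v⟩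
  rw [hsector, measure_sdiff_null (measure_singleton 0)]

theorem setLIntegral_fun_norm_of_cone (hS : MeasurableSet S)
    (hcone : ∀ r : ℝ, 0 < r → ∀ v ∈ S, r • v ∈ S) {f : ℝ → ℝ≥0∞} (hf : Measurable f) :
    ∫⁻ v in S, f ‖v‖ ∂μ = finrank ℝ E * μ (S ∩ Metric.ball 0 1) *
      ∫⁻ r : Ioi (0 : ℝ), f r ∂volumeIoiPow (finrank ℝ E - 1) := by
  let T : Set (Metric.sphere (0 : E) 1) := Subtype.val ⁻¹' S
  have hT : MeasurableSet T := measurable_subtype_coe hS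
  have hpolar : ∀ v : ({0}ᶜ : Set E), S.indicator (fun v => f ‖v‖) (v : E) =
      T.indicator 1 (homeomorphUnitSphereProd E v).1 * f (homeomorphUnitSphereProd E v).2 := by
    intro v
    have hv : 0 < ‖(v : E)‖ := norm_pos_iff.2 v.2
    have hmem : (homeomorphUnitSphereProd E v).1 ∈ T ↔ (v : E) ∈ S := by
      refine ⟨fun h => ?_, fun h => ?_⟩
      · simpa [smul_inv_smul₀ hv.ne'] using hcone _ hv _ h
      · simpa [T] using hcone _ (inv_pos.2 hv) v h
    by_cases hvS : (v : E) ∈ S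
    · simp [hvS, hmem.2 hvS]
    · simp [hvS, hmem.not.2 hvS]
  calc ∫⁻ v in S, f ‖v‖ ∂μ
      = ∫⁻ v in {0}ᶜ, S.indicator (fun v => f ‖v‖) v ∂μ := by
        rw [restrict_compl_singleton, lintegral_indicator hS]
    _ = ∫⁻ z, T.indicator 1 z.1 * f z.2 ∂μ.toSphere.prod (volumeIoiPow (finrank ℝ E - 1)) := by
        rw [← lintegral_subtype_comap (measurableSet_singleton 0).compl, lintegral_congr hpolar]
        exact μ.measurePreserving_homeomorphUnitSphereProd.lintegral_comp_emb
          (homeomorphUnitSphereProd E).measurableEmbedding fun z => T.indicator 1 z.1 * f z.2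
    _ = μ.toSphere T * ∫⁻ r : Ioi (0 : ℝ), f r ∂volumeIoiPow (finrank ℝ E - 1) := by
        rw [lintegral_prod_mul (g := fun r : Ioi (0 : ℝ) => f r)
          (measurable_one.indicator hT).aemeasurable
          (hf.comp measurable_subtype_coe).aemeasurable, lintegral_indicator_one hT]
    _ = _ := by rw [toSphere_preimage_of_cone μ hS hcone]

theorem setLIntegral_fun_norm_mul_measure_ball_of_cone (hS : MeasurableSet S)
    (hcone : ∀ r : ℝ, 0 < r → ∀ v ∈ S, r • v ∈ S) {f : ℝ → ℝ≥0∞} (hf : Measurable f) :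
    (∫⁻ v in S, f ‖v‖ ∂μ) * μ (Metric.ball 0 1) =
      μ (S ∩ Metric.ball 0 1) * ∫⁻ v, f ‖v‖ ∂μ := by
  rw [setLIntegral_fun_norm_of_cone μ hS hcone hf,
    ← setLIntegral_univ fun v => f ‖v‖,
    setLIntegral_fun_norm_of_cone μ .univ (fun _ _ _ _ => mem_univ _) hf, univ_inter]
  ring

theorem lintegral_exp_mul_norm_rpow_lt_top {b p : ℝ} (hb : 0 < b) (hp : p < finrank ℝ E) :
    ∫⁻ v, ENNReal.ofReal (Real.exp (-b * ‖v‖ ^ 2) * ‖v‖ ^ (-p)) ∂μ < ⊤ := by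
  have hradial : IntegrableOn (fun r : ℝ => r ^ (finrank ℝ E - 1) •
      (Real.exp (-b * r ^ 2) * r ^ (-p))) (Ioi 0) := by
    refine (integrableOn_rpow_mul_exp_neg_mul_sq hb (s := finrank ℝ E - 1 - p)
      (by linarith)).congr_fun (fun r hr => ?_) measurableSet_Ioi
    rw [mem_Ioi] at hr
    beta_reduce
    rw [smul_eq_mul, sub_eq_add_neg, Real.rpow_add hr, ← Nat.cast_pred finrank_pos,
      Real.rpow_natCast]
    ring
  exact ((integrable_fun_norm_addHaar μ).2 hradial).lintegral_lt_top

end ConeIntegral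

section ConicalBand

variable {E : Type*} [NormedAddCommGroup E] [InnerProductSpace ℝ E] (n : E) (ε : ℝ)

theorem isClosed_conicalBand : IsClosed (conicalBand n ε) :=
  isClosed_le (by fun_prop) (by fun_prop)

theorem smul_mem_conicalBand (r : ℝ) {v : E} (hv : v ∈ conicalBand n ε) :
    r • v ∈ conicalBand n ε := by
  change |inner ℝ n (r • v)| ≤ ε * ‖r • v‖
  rw [inner_smul_right, abs_mul, norm_smul, Real.norm_eq_abs, mul_left_comm]
  exact mul_le_mul_of_nonneg_left hv (abs_nonneg r)

theorem conicalBand_inter_ball_subset_slab {ε : ℝ} (hε : 0 ≤ ε) :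
    conicalBand n ε ∩ Metric.ball 0 1 ⊆ slab n 0 1 ε := by
  rintro v ⟨hv, hv1⟩
  rw [mem_ball_zero_iff] at hv1
  change ‖v - 0‖ ≤ 1 ∧ |inner ℝ n (v - 0)| ≤ ε
  rw [sub_zero]
  exact ⟨hv1.le, le_trans hv (mul_le_of_le_one_right hε hv1.le)⟩

theorem volume_conicalBand_inter_ball_le {d : ℕ} {n : EuclideanSpace ℝ (Fin (d + 1))}
    (hn : ‖n‖ = 1) {ε : ℝ} (hε : 0 ≤ ε) :
    volume (conicalBand n ε ∩ Metric.ball 0 1) ≤ ENNReal.ofReal (2 ^ (d + 1) * ε) := by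
  refine (measure_mono (conicalBand_inter_ball_subset_slab n hε)).trans
    ((volume_slab_le hn 0 zero_le_one hε).trans_eq ?_)
  congr 1
  ring

end ConicalBand

theorem exists_setLIntegral_conicalBand_le {d : ℕ} {f : ℝ → ℝ≥0∞} (hf : Measurable f)
    (hfin : ∫⁻ v : EuclideanSpace ℝ (Fin (d + 1)), f ‖v‖ < ⊤) :
    ∃ A ≠ (⊤ : ℝ≥0∞), ∀ (n : EuclideanSpace ℝ (Fin (d + 1))) (ε : ℝ), ‖n‖ = 1 → 0 ≤ ε →
      ∫⁻ v in conicalBand n ε, f ‖v‖ ≤ ENNReal.ofReal ε * A := by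
  let B : ℝ≥0∞ := volume (Metric.ball (0 : EuclideanSpace ℝ (Fin (d + 1))) 1)
  have hB0 : B ≠ 0 := (Metric.measure_ball_pos volume 0 one_pos).ne'
  have hB : B ≠ ⊤ := measure_ball_lt_top.ne
  refine ⟨2 ^ (d + 1) * (∫⁻ v : EuclideanSpace ℝ (Fin (d + 1)), f ‖v‖) / B,
    ENNReal.div_ne_top (ENNReal.mul_ne_top (by simp) hfin.ne) hB0, fun n ε hn hε => ?_⟩
  rw [← mul_div_assoc, ENNReal.le_div_iff_mul_le (.inl hB0) (.inl hB),
    setLIntegral_fun_norm_mul_measure_ball_of_cone volume (isClosed_conicalBand n ε).measurableSet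
      (fun r _ v hv => smul_mem_conicalBand n ε r hv) hf, ← mul_assoc, mul_comm (ENNReal.ofReal ε)]
  gcongr
  refine (volume_conicalBand_inter_ball_le hn hε).trans_eq ?_
  rw [ENNReal.ofReal_mul (by positivity), ENNReal.ofReal_pow zero_le_two, ENNReal.ofReal_ofNat]

section InversePower

variable {X : Type*} [MeasurableSpace X] {μ : Measure X} {f : X → ℝ} {C : ℝ≥0∞} {a p : ℝ}

theorem lintegral_rpow_neg_le_tsum (hp : 0 ≤ p) (hf : ∀ᵐ x ∂μ, 0 < f x ∧ f x ≤ 1) :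
    ∫⁻ x, ENNReal.ofReal (f x ^ (-p)) ∂μ ≤
      ∑' k : ℕ, ENNReal.ofReal (((2 : ℝ) ^ (k + 1)) ^ p) * μ {x | f x ≤ (1 / 2) ^ k} := by
  let T (k : ℕ) : Set X := toMeasurable μ {x | f x ≤ (1 / 2) ^ k}
  have hT (k : ℕ) : MeasurableSet (T k) := measurableSet_toMeasurable _ _
  have hdyadic : ∀ᵐ x ∂μ, ENNReal.ofReal (f x ^ (-p)) ≤
      ∑' k : ℕ, (T k).indicator (fun _ => ENNReal.ofReal (((2 : ℝ) ^ (k + 1)) ^ p)) x := by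
    filter_upwards [hf] with x hx
    obtain ⟨k, hk, hk'⟩ :=
      exists_nat_pow_near_of_lt_one hx.1 hx.2 (one_half_pos (α := ℝ)) one_half_lt_one
    refine le_trans ?_ (ENNReal.le_tsum k)
    rw [indicator_of_mem (subset_toMeasurable μ _ hk')]
    refine ENNReal.ofReal_le_ofReal
      ((Real.rpow_le_rpow_of_nonpos (by positivity) hk.le (neg_nonpos.2 hp)).trans_eq ?_)
    rw [one_div, inv_pow, Real.rpow_neg (by positivity), ← Real.inv_rpow (by positivity), inv_inv]
  refine (lintegral_mono_ae hdyadic).trans_eq ?_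
  rw [lintegral_tsum fun k => (measurable_const.indicator (hT k)).aemeasurable]
  simp only [lintegral_indicator_const (hT _), T, measure_toMeasurable]

theorem lintegral_rpow_neg_lt_top_of_measure_le (hp : 0 ≤ p) (hpa : p < a)
    (hf : ∀ᵐ x ∂μ, 0 < f x ∧ f x ≤ 1) (hC : C ≠ ⊤)
    (hμ : ∀ t : ℝ, 0 < t → t ≤ 1 → μ {x | f x ≤ t} ≤ C * ENNReal.ofReal (t ^ a)) :
    ∫⁻ x, ENNReal.ofReal (f x ^ (-p)) ∂μ < ⊤ := by
  have hratio : (2 : ℝ) ^ (p - a) < 1 :=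
    Real.rpow_lt_one_of_one_lt_of_neg one_lt_two (by linarith)
  have hterm (k : ℕ) : ((2 : ℝ) ^ (k + 1)) ^ p * ((1 / 2 : ℝ) ^ k) ^ a =
      2 ^ p * ((2 : ℝ) ^ (p - a)) ^ k := by
    rw [one_div, inv_pow, Real.inv_rpow (by positivity), ← Real.rpow_pow_comm zero_le_two,
      ← Real.rpow_pow_comm zero_le_two, Real.rpow_sub two_pos, pow_succ', div_pow]
    ring
  calc ∫⁻ x, ENNReal.ofReal (f x ^ (-p)) ∂μ
      ≤ ∑' k : ℕ, ENNReal.ofReal (((2 : ℝ) ^ (k + 1)) ^ p) * μ {x | f x ≤ (1 / 2) ^ k} :=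
        lintegral_rpow_neg_le_tsum hp hf
    _ ≤ ∑' k : ℕ, C * ENNReal.ofReal (2 ^ p * ((2 : ℝ) ^ (p - a)) ^ k) := by
        refine ENNReal.tsum_le_tsum fun k => ?_
        rw [← hterm, ENNReal.ofReal_mul (by positivity), mul_left_comm]
        gcongr
        exact hμ _ (by positivity) (pow_le_one₀ (by norm_num) (by norm_num))
    _ < ⊤ := by
        rw [ENNReal.tsum_mul_left]
        exact ENNReal.mul_lt_top hC.lt_top
          ((summable_geometric_of_lt_one (by positivity) hratio).mul_left _).tsum_ofReal_lt_top

end InversePower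

section OutwardNormal

variable {Ω : Set E3} {R : ℝ} {c y z : E3}

theorem IsLocalDefiningFunction.exists_pos_add_smul_mem {ρ : E3 → ℝ}
    (h : IsLocalDefiningFunction Ω z ρ) {u : E3} (hu : inner ℝ (gradient ρ z) u < 0) :
    ∃ t : ℝ, 0 < t ∧ z + t • u ∈ Ω := by
  have hline : HasDerivAt (fun t : ℝ => z + t • u) u 0 := by
    simpa using ((hasDerivAt_id (0 : ℝ)).smul_const u).const_add z
  have hρ : HasFDerivAt ρ (fderiv ℝ ρ z) (z + (0 : ℝ) • u) := by
    simpa using (h.contDiffAt.differentiableAt one_ne_zero).hasFDerivAt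
  have hderiv : deriv (ρ ∘ fun t : ℝ => z + t • u) 0 < 0 := by
    rw [(hρ.comp_hasDerivAt 0 hline).deriv]
    simpa [gradient] using hu
  have hsign := eventually_nhdsWithin_sign_eq_of_deriv_neg hderiv (by simp [h.map_eq_zero])
  have hmem : ∀ᶠ t : ℝ in 𝓝 0, (z + t • u ∈ Ω ↔ ρ (z + t • u) < 0) := by
    have hlim := hline.continuousAt.tendsto
    rw [zero_smul, add_zero] at hlim
    exact hlim.eventually h.mem_iff
  obtain ⟨t, ⟨hsign, hmem⟩, ht⟩ :=
    (((hsign.and hmem).filter_mono nhdsWithin_le_nhds).and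
      (self_mem_nhdsWithin : Ioi (0 : ℝ) ∈ 𝓝[>] 0)).exists
  refine ⟨t, ht, hmem.2 (sign_eq_neg_one_iff.1 (hsign.trans ?_))⟩
  rwa [sign_eq_neg_one_iff, zero_sub, neg_lt_zero]

theorem outwardNormal_eq_of_mem_sphere (hΩC : HasC1Boundary Ω) (hR : 0 < R)
    (hz : z ∈ frontier Ω) (hzc : z ∈ Metric.sphere c R)
    (hΩc : closure Ω ⊆ Metric.closedBall c R) : outwardNormal Ω z = R⁻¹ • (z - c) := by
  have hex := hΩC z hz
  have hρ := hex.choose_spec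
  rw [outwardNormal, dif_pos hex]
  refine eq_of_forall_inner_neg_imp_inner_nonpos ?_ ?_ fun u hu => ?_
  · exact norm_smul_inv_norm (𝕜 := ℝ) hρ.gradient_ne_zero
  · rw [norm_smul, norm_inv, Real.norm_of_nonneg hR.le, mem_sphere_iff_norm.1 hzc,
      inv_mul_cancel₀ hR.ne']
  rw [real_inner_smul_left] at hu ⊢
  obtain ⟨t, ht, hmem⟩ := hρ.exists_pos_add_smul_mem
    (neg_of_mul_neg_right hu (inv_nonneg.2 (norm_nonneg _)))
  have hchord := sq_norm_sub_le_two_mul_inner_of_mem_closedBall hzc (hΩc (subset_closure hmem))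
  rw [sub_add_cancel_left, inner_neg_right, inner_smul_right] at hchord
  have : t * inner ℝ (z - c) u ≤ 0 := by linarith [sq_nonneg ‖-(t • u)‖]
  exact mul_nonpos_of_nonneg_of_nonpos (inv_nonneg.2 hR.le) (nonpos_of_mul_nonpos_right this ht)

theorem norm_outwardNormal (hΩC : HasC1Boundary Ω) (hz : z ∈ frontier Ω) :
    ‖outwardNormal Ω z‖ = 1 := by
  rw [outwardNormal, dif_pos (hΩC z hz)]
  exact norm_smul_inv_norm (𝕜 := ℝ) (hΩC z hz).choose_spec.gradient_ne_zero

theorem sq_norm_sub_le_inner_outwardNormal (hΩC : HasC1Boundary Ω)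
    (hR : UniformCircumscribedSphere Ω R) (hz : z ∈ frontier Ω) (hy : y ∈ closure Ω) :
    ‖z - y‖ ^ 2 ≤ 2 * R * inner ℝ (outwardNormal Ω z) (z - y) := by
  obtain ⟨c, hzc, hΩc⟩ := hR.2 z hz
  rw [outwardNormal_eq_of_mem_sphere hΩC hR.1 hz hzc hΩc, real_inner_smul_left, mul_assoc,
    mul_inv_cancel_left₀ hR.1.ne']
  exact sq_norm_sub_le_two_mul_inner_of_mem_closedBall hzc (hΩc hy)

theorem inner_outwardNormal_nonneg (hΩC : HasC1Boundary Ω)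
    (hR : UniformCircumscribedSphere Ω R) (hz : z ∈ frontier Ω) (hy : y ∈ closure Ω) :
    0 ≤ inner ℝ (outwardNormal Ω z) (z - y) :=
  nonneg_of_mul_nonneg_right
    ((sq_nonneg _).trans (sq_norm_sub_le_inner_outwardNormal hΩC hR hz hy))
    (mul_pos two_pos hR.1)

theorem norm_sub_le_mul_norm_outwardNormal_sub (hΩC : HasC1Boundary Ω)
    (hR : UniformCircumscribedSphere Ω R) (hz : z ∈ frontier Ω) (hy : y ∈ frontier Ω) :
    ‖z - y‖ ≤ R * ‖outwardNormal Ω z - outwardNormal Ω y‖ := by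
  rcases (norm_nonneg (z - y)).eq_or_lt with hzy | hzy
  · rw [← hzy]
    exact mul_nonneg hR.1.le (norm_nonneg _)
  have hz_le := sq_norm_sub_le_inner_outwardNormal hΩC hR hz (frontier_subset_closure hy)
  have hy_le := sq_norm_sub_le_inner_outwardNormal hΩC hR hy (frontier_subset_closure hz)
  rw [← neg_sub z y, norm_neg, inner_neg_right] at hy_le
  refine le_of_mul_le_mul_right ?_ hzy
  calc ‖z - y‖ * ‖z - y‖
      ≤ R * inner ℝ (outwardNormal Ω z - outwardNormal Ω y) (z - y) := by
        rw [inner_sub_left]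
        linarith
    _ ≤ R * (‖outwardNormal Ω z - outwardNormal Ω y‖ * ‖z - y‖) :=
        mul_le_mul_of_nonneg_left (real_inner_le_norm _ _) hR.1.le
    _ = R * ‖outwardNormal Ω z - outwardNormal Ω y‖ * ‖z - y‖ := by ring

end OutwardNormal

section ExitPoint

variable {Ω : Set E3} {R : ℝ} {x v : E3}

theorem exists_nonneg_sub_smul_notMem {E : Type*} [NormedAddCommGroup E] [NormedSpace ℝ E]
    {s : Set E} (hs : Bornology.IsBounded s) (x : E) {v : E} (hv : v ≠ 0) :
    ∃ t : ℝ, 0 ≤ t ∧ x - t • v ∉ s := by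
  obtain ⟨r, hr, hsub⟩ := hs.subset_ball_lt 0 x
  refine ⟨r / ‖v‖, by positivity, fun hmem => (mem_ball_iff_norm.1 (hsub hmem)).ne ?_⟩
  rw [sub_sub_cancel_left, norm_neg, norm_smul, norm_div, norm_norm, Real.norm_of_nonneg hr.le,
    div_mul_cancel₀ _ (norm_ne_zero_iff.2 hv)]

theorem exitTime_nonneg (Ω : Set E3) (x v : E3) : 0 ≤ exitTime Ω x v :=
  Real.sInf_nonneg fun _ hs => hs.1

theorem sub_smul_mem_of_lt_exitTime {s : ℝ} (hs : 0 ≤ s) (hlt : s < exitTime Ω x v) :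
    x - s • v ∈ Ω :=
  not_not.1 fun hmem => notMem_of_lt_csInf hlt ⟨0, fun _ h => h.1⟩ ⟨hs, hmem⟩

theorem exitPoint_notMem (hΩ : IsOpen Ω) (hΩb : Bornology.IsBounded Ω) (x : E3) (hv : v ≠ 0) :
    exitPoint Ω x v ∉ Ω := by
  have hclosed : IsClosed {s : ℝ | 0 ≤ s ∧ x - s • v ∈ Ωᶜ} :=
    isClosed_Ici.inter (hΩ.isClosed_compl.preimage (f := fun s : ℝ => x - s • v) (by fun_prop))
  exact (hclosed.csInf_mem (exists_nonneg_sub_smul_notMem hΩb x hv) ⟨0, fun _ h => h.1⟩).2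

theorem exitTime_pos (hΩ : IsOpen Ω) (hΩb : Bornology.IsBounded Ω) (hx : x ∈ Ω) (hv : v ≠ 0) :
    0 < exitTime Ω x v := by
  refine (exitTime_nonneg Ω x v).lt_of_ne fun h => exitPoint_notMem hΩ hΩb x hv ?_
  rwa [exitPoint, ← h, zero_smul, sub_zero]

theorem exitPoint_mem_frontier (hΩ : IsOpen Ω) (hΩb : Bornology.IsBounded Ω) (hx : x ∈ Ω)
    (hv : v ≠ 0) : exitPoint Ω x v ∈ frontier Ω := by
  rw [hΩ.frontier_eq]
  refine ⟨?_, exitPoint_notMem hΩ hΩb x hv⟩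
  have hcont : Continuous fun s : ℝ => x - s • v := by fun_prop
  refine mem_closure_of_tendsto ((hcont.tendsto (exitTime Ω x v)).mono_left
    (nhdsWithin_le_nhds (s := Iio (exitTime Ω x v)))) ?_
  filter_upwards [Ico_mem_nhdsLT (exitTime_pos hΩ hΩb hx hv)] with s hs
  exact sub_smul_mem_of_lt_exitTime hs.1 hs.2

theorem norm_sub_exitPoint (Ω : Set E3) (x v : E3) :
    ‖x - exitPoint Ω x v‖ = exitTime Ω x v * ‖v‖ := by
  rw [exitPoint, sub_sub_cancel, norm_smul, Real.norm_of_nonneg (exitTime_nonneg Ω x v)]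

theorem inner_outwardNormal_exitPoint_eq (Ω : Set E3) (x v : E3) :
    inner ℝ (outwardNormal Ω (exitPoint Ω x v)) v = -(‖v‖ * exitCosine Ω x v) := by
  rcases eq_or_ne v 0 with rfl | hv
  · simp
  rw [exitCosine, inner_smul_right, mul_neg, neg_neg,
    mul_inv_cancel_left₀ (norm_ne_zero_iff.2 hv)]

theorem norm_sub_exitPoint_le (hΩ : IsOpen Ω) (hΩb : Bornology.IsBounded Ω)
    (hΩC : HasC1Boundary Ω) (hR : UniformCircumscribedSphere Ω R) (hx : x ∈ Ω) (hv : v ≠ 0) :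
    ‖x - exitPoint Ω x v‖ ≤ 2 * R * exitCosine Ω x v := by
  have hlength : 0 < exitTime Ω x v * ‖v‖ :=
    mul_pos (exitTime_pos hΩ hΩb hx hv) (norm_pos_iff.2 hv)
  have hchord := sq_norm_sub_le_inner_outwardNormal hΩC hR (exitPoint_mem_frontier hΩ hΩb hx hv)
    (subset_closure hx)
  rw [norm_sub_rev, norm_sub_exitPoint, exitPoint, sub_sub_cancel_left, ← exitPoint,
    inner_neg_right, inner_smul_right, inner_outwardNormal_exitPoint_eq] at hchord
  rw [norm_sub_exitPoint]
  refine le_of_mul_le_mul_right ?_ hlength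
  linarith

theorem exitCosine_pos (hΩ : IsOpen Ω) (hΩb : Bornology.IsBounded Ω) (hΩC : HasC1Boundary Ω)
    (hR : UniformCircumscribedSphere Ω R) (hx : x ∈ Ω) (hv : v ≠ 0) : 0 < exitCosine Ω x v := by
  have hlength : 0 < ‖x - exitPoint Ω x v‖ := by
    rw [norm_sub_exitPoint]
    exact mul_pos (exitTime_pos hΩ hΩb hx hv) (norm_pos_iff.2 hv)
  exact pos_of_mul_pos_right (hlength.trans_le (norm_sub_exitPoint_le hΩ hΩb hΩC hR hx hv))
    (mul_pos two_pos hR.1).le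

theorem exitCosine_le_one (hΩ : IsOpen Ω) (hΩb : Bornology.IsBounded Ω) (hΩC : HasC1Boundary Ω)
    (hx : x ∈ Ω) (hv : v ≠ 0) : exitCosine Ω x v ≤ 1 :=
  calc exitCosine Ω x v ≤ ‖outwardNormal Ω (exitPoint Ω x v)‖ * ‖‖v‖⁻¹ • v‖ :=
        (neg_le_abs _).trans (abs_real_inner_le_norm _ _)
    _ = 1 := by
        rw [norm_outwardNormal hΩC (exitPoint_mem_frontier hΩ hΩb hx hv), one_mul]
        exact norm_smul_inv_norm (𝕜 := ℝ) hv

end ExitPoint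

section GrazingSet

variable {Ω : Set E3} {R t : ℝ} {q x v z : E3}

theorem abs_inner_outwardNormal_sub_le (hΩC : HasC1Boundary Ω)
    (hR : UniformCircumscribedSphere Ω R) (hz : z ∈ frontier Ω) (hq : q ∈ frontier Ω) :
    |inner ℝ (outwardNormal Ω q) (z - q)| ≤ R * ‖outwardNormal Ω z - outwardNormal Ω q‖ ^ 2 := by
  have hz_nonneg := inner_outwardNormal_nonneg hΩC hR hz (frontier_subset_closure hq)
  have hq_nonneg := inner_outwardNormal_nonneg hΩC hR hq (frontier_subset_closure hz)
  have hq_nonpos : inner ℝ (outwardNormal Ω q) (z - q) ≤ 0 := by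
    rwa [← neg_sub z q, inner_neg_right, neg_nonneg] at hq_nonneg
  calc |inner ℝ (outwardNormal Ω q) (z - q)|
      ≤ inner ℝ (outwardNormal Ω z - outwardNormal Ω q) (z - q) := by
        rw [abs_of_nonpos hq_nonpos, inner_sub_left]
        linarith
    _ ≤ ‖outwardNormal Ω z - outwardNormal Ω q‖ * ‖z - q‖ := real_inner_le_norm _ _
    _ ≤ ‖outwardNormal Ω z - outwardNormal Ω q‖ *
          (R * ‖outwardNormal Ω z - outwardNormal Ω q‖) :=
        mul_le_mul_of_nonneg_left (norm_sub_le_mul_norm_outwardNormal_sub hΩC hR hz hq)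
          (norm_nonneg _)
    _ = R * ‖outwardNormal Ω z - outwardNormal Ω q‖ ^ 2 := by ring

theorem mem_conicalBand_of_exitCosine_le (hΩ : IsOpen Ω) (hΩb : Bornology.IsBounded Ω)
    (hΩC : HasC1Boundary Ω) (hR : UniformCircumscribedSphere Ω R) (hx : x ∈ Ω) (hv : v ≠ 0)
    {m : E3} (hN : exitCosine Ω x v ≤ t) (hm : ‖outwardNormal Ω (exitPoint Ω x v) - m‖ ≤ t) :
    v ∈ conicalBand m (2 * t) := by
  have hN_pos := exitCosine_pos hΩ hΩb hΩC hR hx hv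
  have hnormal : |inner ℝ (outwardNormal Ω (exitPoint Ω x v)) v| ≤ t * ‖v‖ := by
    rw [inner_outwardNormal_exitPoint_eq, abs_neg, abs_mul, abs_norm, abs_of_pos hN_pos, mul_comm]
    gcongr
  have hdiff : |inner ℝ (outwardNormal Ω (exitPoint Ω x v) - m) v| ≤ t * ‖v‖ :=
    (abs_real_inner_le_norm _ _).trans (by gcongr)
  calc |inner ℝ m v|
      = |inner ℝ (outwardNormal Ω (exitPoint Ω x v)) v
          - inner ℝ (outwardNormal Ω (exitPoint Ω x v) - m) v| := by
        rw [inner_sub_left, sub_sub_cancel]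
    _ ≤ t * ‖v‖ + t * ‖v‖ := (abs_sub _ _).trans (add_le_add hnormal hdiff)
    _ = 2 * t * ‖v‖ := by ring

theorem mem_slab_of_exitCosine_le (hΩ : IsOpen Ω) (hΩb : Bornology.IsBounded Ω)
    (hΩC : HasC1Boundary Ω) (hR : UniformCircumscribedSphere Ω R) (hx : x ∈ Ω) (hv : v ≠ 0)
    (hq : q ∈ frontier Ω) (hN : exitCosine Ω x v ≤ t)
    (hnq : ‖outwardNormal Ω (exitPoint Ω x v) - outwardNormal Ω q‖ ≤ t) :
    x ∈ slab (outwardNormal Ω q) q (3 * R * t) (5 * R * t ^ 2) := by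
  have hR0 := hR.1
  have hz := exitPoint_mem_frontier hΩ hΩb hx hv
  have ht : 0 ≤ t := (norm_nonneg _).trans hnq
  have hchord : ‖x - exitPoint Ω x v‖ ≤ 2 * R * t :=
    (norm_sub_exitPoint_le hΩ hΩb hΩC hR hx hv).trans (by gcongr)
  have hbase : ‖exitPoint Ω x v - q‖ ≤ R * t :=
    (norm_sub_le_mul_norm_outwardNormal_sub hΩC hR hz hq).trans (by gcongr)
  have hbase_inner : |inner ℝ (outwardNormal Ω q) (exitPoint Ω x v - q)| ≤ R * t ^ 2 :=
    (abs_inner_outwardNormal_sub_le hΩC hR hz hq).trans (by gcongr)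
  have hchord_inner :
      |inner ℝ (outwardNormal Ω q) (x - exitPoint Ω x v)| ≤ 2 * t * ‖x - exitPoint Ω x v‖ := by
    have hband : |inner ℝ (outwardNormal Ω q) v| ≤ 2 * t * ‖v‖ :=
      mem_conicalBand_of_exitCosine_le hΩ hΩb hΩC hR hx hv hN hnq
    rw [norm_sub_exitPoint, exitPoint, sub_sub_cancel, inner_smul_right, abs_mul,
      abs_of_nonneg (exitTime_nonneg Ω x v), mul_left_comm]
    exact mul_le_mul_of_nonneg_left hband (exitTime_nonneg Ω x v)
  constructor
  · calc ‖x - q‖ ≤ ‖x - exitPoint Ω x v‖ + ‖exitPoint Ω x v - q‖ :=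
          norm_sub_le_norm_sub_add_norm_sub ..
      _ ≤ 2 * R * t + R * t := add_le_add hchord hbase
      _ = 3 * R * t := by ring
  · calc |inner ℝ (outwardNormal Ω q) (x - q)|
        = |inner ℝ (outwardNormal Ω q) (x - exitPoint Ω x v)
            + inner ℝ (outwardNormal Ω q) (exitPoint Ω x v - q)| := by
          rw [← inner_add_right, sub_add_sub_cancel]
      _ ≤ 2 * t * (2 * R * t) + R * t ^ 2 :=
          (abs_add_le _ _).trans (add_le_add (hchord_inner.trans (by gcongr)) hbase_inner)
      _ = 5 * R * t ^ 2 := by ring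

end GrazingSet

section SublevelSet

variable {Ω : Set E3} {R t : ℝ}

theorem exists_finset_forall_norm_outwardNormal_sub_le (hΩC : HasC1Boundary Ω) (ht0 : 0 < t)
    (ht2 : t ≤ 2) :
    ∃ Q : Finset E3, ↑Q ⊆ frontier Ω ∧
      (∀ z ∈ frontier Ω, ∃ q ∈ Q, ‖outwardNormal Ω z - outwardNormal Ω q‖ ≤ t) ∧
      Q.card * t ^ 2 ≤ 96 := by
  classical
  lift t to ℝ≥0 using ht0.le
  have hsphere : outwardNormal Ω '' frontier Ω ⊆ Metric.sphere 0 1 := by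
    rintro _ ⟨z, hz, rfl⟩
    exact mem_sphere_zero_iff_norm.2 (norm_outwardNormal hΩC hz)
  obtain ⟨C, hC, hcover, hcard⟩ := exists_finset_isCover_of_subset_sphere hsphere ht0 ht2
  have hnormals : ∀ n ∈ C, ∃ q ∈ frontier Ω, outwardNormal Ω q = n := hC
  choose! q hq hqC using hnormals
  refine ⟨C.image q, ?_, fun z hz => ?_, ?_⟩
  · rw [Finset.coe_image]
    exact image_subset_iff.2 hq
  · obtain ⟨n, hn, hzn⟩ := hcover (mem_image_of_mem _ hz)
    refine ⟨q n, Finset.mem_image_of_mem q hn, ?_⟩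
    rw [hqC n hn, ← dist_eq_norm]
    exact edist_le_coe.1 hzn
  · rw [finrank_euclideanSpace_fin] at hcard
    have himage : ((C.image q).card : ℝ) ≤ C.card := mod_cast Finset.card_image_le
    nlinarith [sq_nonneg (t : ℝ)]

theorem setOf_exitCosine_le_subset (hΩ : IsOpen Ω) (hΩb : Bornology.IsBounded Ω)
    (hΩC : HasC1Boundary Ω) (hR : UniformCircumscribedSphere Ω R) {Q : Finset E3}
    (hQ : ↑Q ⊆ frontier Ω)
    (hcover : ∀ z ∈ frontier Ω, ∃ q ∈ Q, ‖outwardNormal Ω z - outwardNormal Ω q‖ ≤ t) :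
    {z : E3 × E3 | z.1 ∈ Ω ∧ z.2 ≠ 0 ∧ exitCosine Ω z.1 z.2 ≤ t} ⊆
      ⋃ q ∈ Q, slab (outwardNormal Ω q) q (3 * R * t) (5 * R * t ^ 2) ×ˢ
        conicalBand (outwardNormal Ω q) (2 * t) := by
  rintro ⟨x, v⟩ ⟨hx, hv, hN⟩
  obtain ⟨q, hq, hnq⟩ := hcover _ (exitPoint_mem_frontier hΩ hΩb hx hv)
  exact mem_biUnion hq ⟨mem_slab_of_exitCosine_le hΩ hΩb hΩC hR hx hv (hQ hq) hN hnq,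
    mem_conicalBand_of_exitCosine_le hΩ hΩb hΩC hR hx hv hN hnq⟩

variable {ν : Measure E3} {A : ℝ≥0∞}

theorem measure_setOf_exitCosine_le_le (hΩ : IsOpen Ω) (hΩb : Bornology.IsBounded Ω)
    (hΩC : HasC1Boundary Ω) (hR : UniformCircumscribedSphere Ω R)
    (hν : ∀ (n : E3) (ε : ℝ), ‖n‖ = 1 → 0 ≤ ε → ν (conicalBand n ε) ≤ ENNReal.ofReal ε * A)
    (ht0 : 0 < t) (ht2 : t ≤ 2) :
    (volume.prod ν) {z : E3 × E3 | z.1 ∈ Ω ∧ z.2 ≠ 0 ∧ exitCosine Ω z.1 z.2 ≤ t} ≤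
      ENNReal.ofReal (69120 * R ^ 3) * A * ENNReal.ofReal (t ^ 3) := by
  obtain ⟨Q, hQ, hcover, hcard⟩ := exists_finset_forall_norm_outwardNormal_sub_le hΩC ht0 ht2
  have hR0 := hR.1
  have hpiece : ∀ q ∈ Q, (volume.prod ν) (slab (outwardNormal Ω q) q (3 * R * t) (5 * R * t ^ 2) ×ˢ
      conicalBand (outwardNormal Ω q) (2 * t)) ≤ ENNReal.ofReal (720 * R ^ 3 * t ^ 5) * A := by
    intro q hq
    have hn := norm_outwardNormal hΩC (hQ hq)
    refine (Measure.prod_prod_le _ _).trans ?_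
    calc _ ≤ ENNReal.ofReal (2 * (5 * R * t ^ 2) * (2 * (3 * R * t)) ^ 2) *
          (ENNReal.ofReal (2 * t) * A) :=
        mul_le_mul' (volume_slab_le hn q (by positivity) (by positivity))
          (hν _ _ hn (by positivity))
      _ = ENNReal.ofReal (720 * R ^ 3 * t ^ 5) * A := by
        rw [← mul_assoc, ← ENNReal.ofReal_mul (by positivity)]
        ring_nf
  calc (volume.prod ν) {z : E3 × E3 | z.1 ∈ Ω ∧ z.2 ≠ 0 ∧ exitCosine Ω z.1 z.2 ≤ t}
      ≤ ∑ _q ∈ Q, ENNReal.ofReal (720 * R ^ 3 * t ^ 5) * A :=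
        (measure_mono (setOf_exitCosine_le_subset hΩ hΩb hΩC hR hQ hcover)).trans
          ((measure_biUnion_finset_le _ _).trans (Finset.sum_le_sum hpiece))
    _ = ENNReal.ofReal (Q.card * t ^ 2 * (720 * R ^ 3 * t ^ 3)) * A := by
        rw [Finset.sum_const, nsmul_eq_mul, ← mul_assoc, ← ENNReal.ofReal_natCast,
          ← ENNReal.ofReal_mul (by positivity)]
        ring_nf
    _ ≤ ENNReal.ofReal (96 * (720 * R ^ 3 * t ^ 3)) * A := by gcongr
    _ = ENNReal.ofReal (69120 * R ^ 3) * A * ENNReal.ofReal (t ^ 3) := by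
        rw [mul_right_comm (ENNReal.ofReal _), ← ENNReal.ofReal_mul (by positivity)]
        congr 2
        ring

end SublevelSet

section PhaseSpace

variable {Ω : Set E3} {R : ℝ}

theorem measurableSet_phaseDomain (hΩ : IsOpen Ω) : MeasurableSet (phaseDomain Ω) :=
  hΩ.measurableSet.prod .univ

theorem ae_restrict_phaseDomain (hΩ : IsOpen Ω) :
    ∀ᵐ z : E3 × E3 ∂volume.restrict (phaseDomain Ω), z.1 ∈ Ω ∧ z.2 ≠ 0 := by
  have hne : ∀ᵐ z : E3 × E3, z.2 ≠ 0 :=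
    Measure.quasiMeasurePreserving_snd.ae (p := fun v : E3 => v ≠ 0) (Measure.ae_ne volume 0)
  filter_upwards [ae_restrict_mem (measurableSet_phaseDomain hΩ), ae_restrict_of_ae hne]
    with z hz hv
  exact ⟨hz.1, hv⟩

theorem lintegral_mul_rpow_neg_exitCosine_lt_top (hΩ : IsOpen Ω) (hΩb : Bornology.IsBounded Ω)
    (hΩC : HasC1Boundary Ω) (hR : UniformCircumscribedSphere Ω R) {p : ℝ} (hp : 0 ≤ p)
    (hp3 : p < 3) {f : ℝ → ℝ≥0∞} (hf : Measurable f) (hf_top : ∀ r, f r < ⊤)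
    (hf_int : ∫⁻ v : E3, f ‖v‖ < ⊤) :
    ∫⁻ z in phaseDomain Ω, f ‖z.2‖ * ENNReal.ofReal (exitCosine Ω z.1 z.2 ^ (-p)) < ⊤ := by
  let ν : Measure E3 := volume.withDensity fun v => f ‖v‖
  let μ : Measure (E3 × E3) := (volume.prod ν).restrict (phaseDomain Ω)
  have hμ : μ = (volume.restrict (phaseDomain Ω)).withDensity fun z => f ‖z.2‖ := by
    rw [← restrict_withDensity (measurableSet_phaseDomain hΩ), Measure.volume_eq_prod,
      ← prod_withDensity_right (g := fun v : E3 => f ‖v‖) (by fun_prop)]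
  have hae : ∀ᵐ z ∂μ, z.1 ∈ Ω ∧ z.2 ≠ 0 := by
    rw [hμ]
    exact (withDensity_absolutelyContinuous _ _).ae_le (ae_restrict_phaseDomain hΩ)
  obtain ⟨A, hA, hband⟩ := exists_setLIntegral_conicalBand_le hf hf_int
  have hν : ∀ (n : E3) (ε : ℝ), ‖n‖ = 1 → 0 ≤ ε → ν (conicalBand n ε) ≤ ENNReal.ofReal ε * A := by
    intro n ε hn hε
    rw [withDensity_apply _ (isClosed_conicalBand n ε).measurableSet]
    exact hband n ε hn hε
  have hsublevel : ∀ t : ℝ, 0 < t → t ≤ 1 → μ {z | exitCosine Ω z.1 z.2 ≤ t} ≤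
      ENNReal.ofReal (69120 * R ^ 3) * A * ENNReal.ofReal (t ^ (3 : ℝ)) := by
    intro t ht0 ht1
    rw [Real.rpow_ofNat]
    refine le_trans (measure_mono_ae ?_) ((Measure.restrict_le_self _).trans
      (measure_setOf_exitCosine_le_le hΩ hΩb hΩC hR hν ht0 (ht1.trans one_le_two)))
    filter_upwards [hae] with z hz hN using ⟨hz.1, hz.2, hN⟩
  have hlintegral := lintegral_rpow_neg_lt_top_of_measure_le hp hp3
    (hae.mono fun z hz => ⟨exitCosine_pos hΩ hΩb hΩC hR hz.1 hz.2,
      exitCosine_le_one hΩ hΩb hΩC hz.1 hz.2⟩)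
    (ENNReal.mul_ne_top ENNReal.ofReal_ne_top hA) hsublevel
  rwa [hμ, lintegral_withDensity_eq_lintegral_mul_non_measurable _
    (by fun_prop) (.of_forall fun z => hf_top _)] at hlintegral

theorem eLpNorm_exp_mul_inv_exitCosine_lt_top (hΩ : IsOpen Ω) (hΩb : Bornology.IsBounded Ω)
    (hΩC : HasC1Boundary Ω) (hR : UniformCircumscribedSphere Ω R) {b : ℝ} (hb : 0 < b) {p : ℝ≥0∞}
    (hp0 : p ≠ 0) (hp3 : p < 3) :
    eLpNorm (fun z : E3 × E3 =>
      Real.exp (-b * ‖z.2‖ ^ 2) * ‖z.2‖⁻¹ * (exitCosine Ω z.1 z.2)⁻¹) p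
      (volume.restrict (phaseDomain Ω)) < ⊤ := by
  lift p to ℝ≥0 using hp3.ne_top
  have hp_pos : (0 : ℝ) < p := NNReal.coe_pos.2 (pos_iff_ne_zero.2 (mod_cast hp0))
  have hp_lt : (p : ℝ) < 3 := mod_cast hp3
  rw [eLpNorm_lt_top_iff_lintegral_rpow_enorm_lt_top hp0 ENNReal.coe_ne_top, ENNReal.coe_toReal]
  refine lt_of_eq_of_lt (lintegral_congr_ae ?_)
    (lintegral_mul_rpow_neg_exitCosine_lt_top hΩ hΩb hΩC hR hp_pos.le hp_lt
      (f := fun r => ENNReal.ofReal (Real.exp (-(b * p) * r ^ 2) * r ^ (-(p : ℝ)))) (by fun_prop)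
      (fun _ => ENNReal.ofReal_lt_top)
      (lintegral_exp_mul_norm_rpow_lt_top volume (by positivity) (by simpa using hp_lt)))
  filter_upwards [ae_restrict_phaseDomain hΩ] with z hz
  have hN := exitCosine_pos hΩ hΩb hΩC hR hz.1 hz.2
  rw [Real.enorm_of_nonneg (by positivity),
    ENNReal.ofReal_rpow_of_nonneg (by positivity) hp_pos.le, ← ENNReal.ofReal_mul (by positivity),
    Real.mul_rpow (by positivity) (by positivity), Real.mul_rpow (by positivity) (by positivity),
    ← Real.exp_mul, Real.inv_rpow (norm_nonneg _), Real.inv_rpow hN.le,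
    Real.rpow_neg (norm_nonneg _), Real.rpow_neg hN.le]
  ring_nf

theorem one_add_le_mul_exp {α : ℝ} (hα : 0 < α) (r : ℝ) :
    1 + r ≤ (2 + 2 / α) * Real.exp (α / 2 * r ^ 2) :=
  calc 1 + r ≤ 2 + α * r ^ 2 + r ^ 2 + 2 / α := by
        nlinarith [sq_nonneg (r - 1), mul_nonneg hα.le (sq_nonneg r), div_pos two_pos hα]
    _ = (2 + 2 / α) * (α / 2 * r ^ 2 + 1) := by
        field_simp
        ring
    _ ≤ (2 + 2 / α) * Real.exp (α / 2 * r ^ 2) := by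
        gcongr
        exact Real.add_one_le_exp _

theorem le_mul_exp_of_exp_mul_div_le {α r N S y : ℝ} (hα : 0 < α) (hr : 0 < r) (hN : 0 < N)
    (hS : 0 ≤ S) (h : Real.exp (α * r ^ 2) * (r / (r + 1) * N * y) ≤ S) :
    y ≤ S * (2 + 2 / α) * (Real.exp (-(α / 2) * r ^ 2) * r⁻¹ * N⁻¹) :=
  calc y = Real.exp (α * r ^ 2) * (r / (r + 1) * N * y) *
          ((1 + r) * Real.exp (-(α * r ^ 2)) * r⁻¹ * N⁻¹) := by
        rw [Real.exp_neg]
        field_simp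
        ring
    _ ≤ S * ((2 + 2 / α) * Real.exp (α / 2 * r ^ 2) * Real.exp (-(α * r ^ 2)) * r⁻¹ * N⁻¹) := by
        gcongr
        exact one_add_le_mul_exp hα r
    _ = S * (2 + 2 / α) * (Real.exp (-(α / 2) * r ^ 2) * r⁻¹ * N⁻¹) := by
        rw [mul_assoc (2 + 2 / α), ← Real.exp_add]
        ring_nf

variable {F : Type*} [NormedAddCommGroup F] [NormedSpace ℝ F]

theorem memLp_of_expSupNorm_kineticWeight_smul_lt_top (hΩ : IsOpen Ω)
    (hΩb : Bornology.IsBounded Ω) (hΩC : HasC1Boundary Ω) (hR : UniformCircumscribedSphere Ω R)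
    {α : ℝ} (hα : 0 < α) {p : ℝ≥0∞} (hp0 : p ≠ 0) (hp3 : p < 3) {g : E3 × E3 → F}
    (hgm : AEStronglyMeasurable g (volume.restrict (phaseDomain Ω)))
    (hg : expSupNorm Ω α (fun z => kineticWeight Ω z.1 z.2 • g z) < ⊤) :
    MemLp g p (volume.restrict (phaseDomain Ω)) := by
  let S : ℝ := (expSupNorm Ω α fun z => kineticWeight Ω z.1 z.2 • g z).toReal
  have hbound : ∀ᵐ z : E3 × E3 ∂volume.restrict (phaseDomain Ω), ‖g z‖ ≤ S * (2 + 2 / α) *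
      ‖Real.exp (-(α / 2) * ‖z.2‖ ^ 2) * ‖z.2‖⁻¹ * (exitCosine Ω z.1 z.2)⁻¹‖ := by
    filter_upwards [ae_restrict_phaseDomain hΩ, ENNReal.ae_le_essSup fun z : E3 × E3 =>
      ENNReal.ofReal (Real.exp (α * ‖z.2‖ ^ 2) * ‖kineticWeight Ω z.1 z.2 • g z‖)] with z hz hle
    have hN := exitCosine_pos hΩ hΩb hΩC hR hz.1 hz.2
    have hS := (ENNReal.ofReal_le_iff_le_toReal hg.ne).1 hle
    rw [norm_smul, kineticWeight, Real.norm_of_nonneg (by positivity)] at hS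
    rw [Real.norm_of_nonneg (by positivity)]
    exact le_mul_exp_of_exp_mul_div_le hα (norm_pos_iff.2 hz.2) hN ENNReal.toReal_nonneg hS
  exact ⟨hgm, (eLpNorm_le_mul_eLpNorm_of_ae_le_mul hbound p).trans_lt
    (ENNReal.mul_lt_top ENNReal.ofReal_lt_top
      (eLpNorm_exp_mul_inv_exitCosine_lt_top hΩ hΩb hΩC hR (half_pos hα) hp0 hp3))⟩

theorem expSupNorm_kineticWeight_smul_le (hΩ : IsOpen Ω) (hΩb : Bornology.IsBounded Ω)
    (hΩC : HasC1Boundary Ω) (hR : UniformCircumscribedSphere Ω R) (α : ℝ) (g : E3 × E3 → F) :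
    expSupNorm Ω α (fun z => kineticWeight Ω z.1 z.2 • g z) ≤ expSupNorm Ω α g := by
  refine essSup_mono_ae ?_
  filter_upwards [ae_restrict_phaseDomain hΩ] with z hz
  have hN := exitCosine_pos hΩ hΩb hΩC hR hz.1 hz.2
  have hw0 : 0 ≤ kineticWeight Ω z.1 z.2 := mul_nonneg (by positivity) hN.le
  have hw1 : kineticWeight Ω z.1 z.2 ≤ 1 :=
    mul_le_one₀ (div_le_one_of_le₀ (by linarith) (by positivity)) hN.le
      (exitCosine_le_one hΩ hΩb hΩC hz.1 hz.2)
  rw [norm_smul, Real.norm_of_nonneg hw0]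
  gcongr
  exact mul_le_of_le_one_left (norm_nonneg _) hw1

end PhaseSpace

theorem mainTheorem5_general (Ω : Set E3) (hΩ : IsOpen Ω) (hΩb : Bornology.IsBounded Ω)
    (hΩC : HasC1Boundary Ω) (R : ℝ) (hR : UniformCircumscribedSphere Ω R)
    (α : ℝ) (hα : 0 < α) (p : ℝ≥0∞) (hp0 : p ≠ 0) (hp3 : p < 3) :
    hatLInfty Ω α ⊆ sobolevW1 (phaseDomain Ω) p := by
  rintro f ⟨gx, gv, hgrad, hnorm⟩
  simp only [ENNReal.add_lt_top] at hnorm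
  obtain ⟨⟨hf, hgx⟩, hgv⟩ := hnorm
  have hfw := (expSupNorm_kineticWeight_smul_le hΩ hΩb hΩC hR α f).trans_lt hf
  have hmemLp {F : Type} [NormedAddCommGroup F] [NormedSpace ℝ F] {g : E3 × E3 → F} :=
    memLp_of_expSupNorm_kineticWeight_smul_lt_top (g := g) hΩ hΩb hΩC hR hα hp0 hp3
  exact ⟨hmemLp hgrad.locallyIntegrableOn.aestronglyMeasurable hfw, gx, gv, hgrad,
    hmemLp hgrad.locallyIntegrableOn_x.aestronglyMeasurable hgx,
    hmemLp hgrad.locallyIntegrableOn_v.aestronglyMeasurable hgv⟩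

theorem mainTheorem5 (Ω : Set E3) (hΩ : IsOpen Ω) (hΩb : Bornology.IsBounded Ω)
    (hΩC : HasC1Boundary Ω) (R : ℝ) (hR : UniformCircumscribedSphere Ω R)
    (α : ℝ) (hα : 0 < α) (p : ℝ≥0∞) (hp1 : 1 ≤ p) (hp3 : p < 3) :
    hatLInfty Ω α ⊆ sobolevW1 (phaseDomain Ω) p :=
  mainTheorem5_general Ω hΩ hΩb hΩC R hR α hα p (one_pos.trans_le hp1).ne' hp3
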